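/- Consider the real massless right-moving scalar field $\phi(x)=\frac1{\sqrt{2\pi}}\int_0^\infty\frac{dk}{2k}\,\bigl(a(k)e^{-ikx}+a^\dagger(k)e^{ikx}\bigr)$, $[a(k),a^\dagger(k')]=2k\,\delta(k-k')$, on the bosonic Fock space over $L^2(\mathbb R_+,\frac{dk}{2k})$ with vacuum $\Omega_o$. Let $x:\mathbb R\to\mathbb R$, $y\mapsto x(y)$, be a coordinate transformation, i.e. a $C^1$ map with $x'(y)>0$ for all $y$ (its range may be a proper interval), and let $\hat\phi(y)=\phi(x(y))$ be the outgoing field. Let $f:\mathbb R\to\mathbb C$ be integrable, with Fourier transform $\tilde f(p)=\frac1{\sqrt{2\pi}}\int e^{-ipy}f(y)\,dy$ vanishing for $p<0$ and normalized: $\int_0^\infty\frac{dp}{2p}|\tilde f(p)|^2=1$. Put $$(U\tilde f)(k)=\frac1{\sqrt{2\pi}}\int_{-\infty}^{\infty} e^{-ikx(y)}f(y)\,dy,\qquad (A\tilde f)(k)=\theta(k)\,(U\tilde f)(k).$$ For $\tilde g\in L^2(\mathbb R_+,\frac{dk}{2k})$ with $\|\tilde g\|=1$ let $\Omega_g=\phi[g]^\dagger\Omega_o=\int_0^\infty\frac{dk}{2k}\,\tilde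 g(k)^*a^\dagger(k)\,\Omega_o$. With $\hat\phi[f]=\int f(y)\hat\phi(y)\,dy$ define the mean numbers of spontaneously created and of stimulated particles $$\bar N_o[f]=(\Omega_o,\hat\phi[f]^\dagger\hat\phi[f]\,\Omega_o)=\|\hat\phi[f]\,\Omega_o\|^2,\qquad \bar N_g[f]=(\Omega_g,\hat\phi[f]^\dagger\hat\phi[f]\,\Omega_g)=\|\hat\phi[f]\,\Omega_g\|^2,$$ which are elements of $[0,\infty]$. **Theorem.** For every such $x$ and $f$: 1. for every normalized $\tilde g\in L^2(\mathbb R_+,\frac{dk}{2k})$, $\ \bar N_o[f]\le\bar N_g[f]\le 1+3\,\bar N_o[f]$ in $[0,\infty]$; 2. if $\|A\tilde f\|<\infty$ (the norm being that of $L^2(\mathbb R_+,\frac{dk}{2k})$), then $\|A\tilde f\|>0$, the classical incoming function $\tilde g_{cl}=A\tilde f/\|A\tilde f\|$ is a normalized element of $L^2(\mathbb R_+,\frac{dk}{2k})$, and $\ 1+\bar N_o[f]\le\bar N_{g_{cl}}[f]$. -/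

import Mathlib

open MeasureTheory
open scoped ENNReal ComplexConjugate

namespace StimulatedEmission

noncomputable section

/-- An (orientation preserving) transformation of coordinates `y ↦ x(y)`, `y ∈ ℝ`: a `C¹` map with
positive derivative, hence a diffeomorphism of `ℝ` onto an open interval, which need not be all of
`ℝ`. -/
structure IsCoordTransformation (x : ℝ → ℝ) : Prop where
  contDiff : ContDiff ℝ 1 x
  deriv_pos : ∀ y, 0 < deriv x y

/-- The measure `dk / 2k` on the half-line `k > 0`. -/
def dk : Measure ℝ :=
  (volume.restrict (Set.Ioi 0)).withDensity fun k => ENNReal.ofReal (1 / (2 * k))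

/-- The norm of `L²(dk/2k, ℝ₊)`, with value `∞` on functions that are not in this space. -/
def waveNorm (u : ℝ → ℂ) : ℝ≥0∞ := eLpNorm u 2 dk

/-- `u` is a normalized element of `L²(dk/2k, ℝ₊)` (only the values `u k` with `k > 0` matter). -/
def IsNormalizedWave (u : ℝ → ℂ) : Prop := MemLp u 2 dk ∧ waveNorm u = 1

/-- The Fourier transform `(2π)^(-1/2) ∫ e^{-ipy} f(y) dy`. -/
def momentum (f : ℝ → ℂ) (p : ℝ) : ℂ :=
  ((Real.sqrt (2 * Real.pi))⁻¹ : ℝ) * ∫ y : ℝ, Complex.exp (-(Complex.I * p * y)) * f y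

/-- `f = f(y)` is an integrable function whose Fourier transform is a normalized wave function,
that is, vanishes at negative momenta and is a unit vector of `L²(dp/2p, ℝ₊)`. -/
structure IsOutgoingWave (f : ℝ → ℂ) : Prop where
  integrable : Integrable f
  momentum_neg : ∀ p < 0, momentum f p = 0
  normalized : IsNormalizedWave (momentum f)

/-- The operator `U` with kernel `U(k,p) = (2π)⁻¹ ∫ e^{-ikx(y)} e^{ipy} dy` applied to the Fourier
transform of `f`. The integral over `p` gives back `(2π)^(1/2) f(y)`. The result is the
Fourier transform of the incoming test function that corresponds to `f`. -/
def opU (x : ℝ → ℝ) (f : ℝ → ℂ) (k : ℝ) : ℂ :=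
  ((Real.sqrt (2 * Real.pi))⁻¹ : ℝ) * ∫ y : ℝ, Complex.exp (-(Complex.I * k * x y)) * f y

/-- The positive momentum part `A` of `U`. -/
def opA (x : ℝ → ℝ) (f : ℝ → ℂ) (k : ℝ) : ℂ := if 0 < k then opU x f k else 0

/-- The negative momentum part `B` of `U`. -/
def opB (x : ℝ → ℝ) (f : ℝ → ℂ) (k : ℝ) : ℂ := if 0 < k then opU x f (-k) else 0

/-! ### The incoming Fock space of the real massless (right moving) scalar field -/

/-- Sequences of `n`-particle momentum space functions. Fock space vectors are the symmetric ones
of finite `fockNormSq`. -/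
abbrev FockVector : Type := (n : ℕ) → (Fin n → ℝ) → ℂ

/-- The square of the Fock space norm, `∑ₙ ∫ |Ψₙ(k₁, …, kₙ)|² dk₁/2k₁ ⋯ dkₙ/2kₙ`, with value `∞`
when `Ψ` is not in Fock space. -/
def fockNormSq (Ψ : FockVector) : ℝ≥0∞ :=
  ∑' n, ∫⁻ k, ‖Ψ n k‖ₑ ^ 2 ∂(Measure.pi fun _ : Fin n => dk)

/-- The vacuum `Ω_o`. -/
def vacuum : FockVector
  | 0, _ => 1
  | _ + 1, _ => 0

/-- `∫ dk/2k u(k) a(k)`, where `[a(k), a†(k')] = 2k δ(k - k')`. -/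
def annihilate (u : ℝ → ℂ) (Ψ : FockVector) : FockVector := fun n k =>
  (Real.sqrt (n + 1) : ℂ) * ∫ q, u q * Ψ (n + 1) (Fin.cons q k) ∂dk

/-- `∫ dk/2k u(k) a†(k)`. -/
def create (u : ℝ → ℂ) (Ψ : FockVector) : FockVector
  | 0, _ => 0
  | n + 1, k =>
    ((Real.sqrt (n + 1))⁻¹ : ℝ) * ∑ j : Fin (n + 1), u (k j) * Ψ n (fun i => k (j.succAbove i))

/-- The smeared incoming field `φ[h] = ∫ h(x) φ(x) dx`, where
`φ(x) = (2π)^(-1/2) ∫ dk/2k (a(k) e^{-ikx} + a†(k) e^{ikx})`; the argument `H` is the Fourier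
transform of `h`, so that `φ[h] = ∫ dk/2k (H(k) a(k) + H(-k) a†(k))`. -/
def inField (H : ℝ → ℂ) (Ψ : FockVector) : FockVector := fun n k =>
  annihilate H Ψ n k + create (fun q => H (-q)) Ψ n k

/-- The adjoint `φ[h]† = φ[h*]`; the Fourier transform of `h*` is `k ↦ H(-k)*`. -/
def inFieldAdj (H : ℝ → ℂ) (Ψ : FockVector) : FockVector :=
  inField (fun k => conj (H (-k))) Ψ

/-- The smeared outgoing field `∫ f(y) φ(x(y)) dy`. -/
def outField (x : ℝ → ℝ) (f : ℝ → ℂ) (Ψ : FockVector) : FockVector :=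
  inField (opU x f) Ψ

/-- The one-particle state `Ω_g = φ[g]† Ω_o`; the argument `g` is the momentum space wave function,
which is extended by `0` to `k ≤ 0`. -/
def oneParticle (g : ℝ → ℂ) : FockVector :=
  inFieldAdj (fun k => if 0 < k then g k else 0) vacuum

/-- The mean number of outgoing particles with wave function `f` in the incoming state `Ψ`: the
expectation value `(Ψ, φ̂[f]† φ̂[f] Ψ) = ‖φ̂[f] Ψ‖²`, where `φ̂` is the outgoing field. -/
def meanNumber (x : ℝ → ℝ) (f : ℝ → ℂ) (Ψ : FockVector) : ℝ≥0∞ := fockNormSq (outField x f Ψ)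

/-- The mean number of spontaneously created particles. -/
def spontaneousNumber (x : ℝ → ℝ) (f : ℝ → ℂ) : ℝ≥0∞ := meanNumber x f vacuum

/-- The mean number of particles stimulated by the one-particle state `Ω_g`. -/
def stimulatedNumber (x : ℝ → ℝ) (g f : ℝ → ℂ) : ℝ≥0∞ := meanNumber x f (oneParticle g)

/-- The classical incoming wave function `A f / ‖A f‖`; meaningful when `0 < ‖A f‖ < ∞`. -/
def classicalWave (x : ℝ → ℝ) (f : ℝ → ℂ) (k : ℝ) : ℂ :=
  ((waveNorm (opA x f)).toReal⁻¹ : ℝ) * opA x f k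

end

end StimulatedEmission

open StimulatedEmission

open Filter Topology

namespace StimulatedEmission

/-! The field `φ̂[f]` turns the vacuum into a one-particle vector with wave function `B f`, so the
spontaneous number is `‖B f‖²`. It turns `Ω_g` into a vacuum component, the pairing of `A f` with
`g`, plus the symmetrized product of `B f` and `g*`, whose squared norm lies between `‖B f‖²` and
`2‖B f‖²` (`le_lintegral_symmetrization`, `lintegral_symmetrization_le`). Cauchy–Schwarz bounds the
pairing by `‖A f‖`, with equality for the classical wave.

Both parts then follow from the conservation law `‖A f‖² - ‖B f‖² = 1`, used as the two inequalities
of `waveNorm_opA_sq_bounds` because both norms may be infinite. On a momentum shell, `∫ (|U f(k)|² -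
|U f(-k)|²) dk/2k` is a double integral of `f(y)* f(y')` against differences of sine integrals of
multiples of `x(y) - x(y')`. As the shells exhaust the half-line, these differences converge
boundedly to a constant times `sgn(x(y) - x(y')) = sgn(y - y')`, so the limit does not depend on
`x`. For `x = id` it is 1 by the normalization of `f`; hence the value `π/2` of the constant is
never needed. -/

/-! ### The sine integral: boundedness and limits. -/

/-- The sine integral `∫₀ʳ sin t / t dt`. -/
noncomputable def sineIntegral (r : ℝ) : ℝ := ∫ t in (0 : ℝ)..r, Real.sinc t

theorem continuous_sineIntegral : Continuous sineIntegral :=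
  intervalIntegral.continuous_primitive
    (fun a b => Real.continuous_sinc.intervalIntegrable a b) 0

@[simp] theorem sineIntegral_zero : sineIntegral 0 = 0 := by simp [sineIntegral]

theorem sineIntegral_neg (r : ℝ) : sineIntegral (-r) = -sineIntegral r := by
  have h := intervalIntegral.integral_comp_neg (a := 0) (b := r) Real.sinc
  simp only [Real.sinc_neg, neg_zero] at h
  rw [sineIntegral, sineIntegral, intervalIntegral.integral_symm, ← h]

/-- Integration by parts replaces the conditionally convergent tail by an absolutely convergent one.
-/
theorem sineIntegral_eq {r : ℝ} (hr : 1 ≤ r) :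
    sineIntegral r =
      sineIntegral 1 + (Real.cos 1 - r⁻¹ * Real.cos r - ∫ t in (1 : ℝ)..r, Real.cos t / t ^ 2) := by
  have hpos : ∀ t ∈ Set.uIcc 1 r, 0 < t := fun t ht => by
    rw [Set.uIcc_of_le hr] at ht; linarith [ht.1]
  have hc : ContinuousOn (fun t : ℝ => (t ^ 2)⁻¹) (Set.uIcc 1 r) :=
    (by fun_prop : ContinuousOn (fun t : ℝ => t ^ 2) _).inv₀
      fun t ht => pow_ne_zero 2 (hpos t ht).ne'
  have h := intervalIntegral.integral_mul_deriv_eq_deriv_mul (a := 1) (b := r)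
    (u := fun t => t⁻¹) (u' := fun t => -(t ^ 2)⁻¹) (v := fun t => -Real.cos t) (v' := Real.sin)
    (fun t ht => hasDerivAt_inv (hpos t ht).ne')
    (fun t _ => by simpa using! (Real.hasDerivAt_cos t).neg)
    hc.neg.intervalIntegrable (Real.continuous_sin.intervalIntegrable _ _)
  rw [sineIntegral, sineIntegral, ← intervalIntegral.integral_add_adjacent_intervals
    (Real.continuous_sinc.intervalIntegrable 0 1) (Real.continuous_sinc.intervalIntegrable 1 r)]
  congr 1
  rw [intervalIntegral.integral_congr (g := fun t => t⁻¹ * Real.sin t), h]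
  · rw [intervalIntegral.integral_congr (g := fun t : ℝ => Real.cos t / t ^ 2)]
    · simp
      ring
    · intro t _
      simp only
      ring
  · intro t ht
    simp only
    rw [Real.sinc_of_ne_zero (hpos t ht).ne']
    ring

theorem integrableOn_cos_div_sq :
    IntegrableOn (fun t : ℝ => Real.cos t / t ^ 2) (Set.Ioi 1) := by
  have h : IntegrableOn (fun t : ℝ => t ^ (-2 : ℝ)) (Set.Ioi 1) :=
    integrableOn_Ioi_rpow_of_lt (by norm_num) one_pos
  refine Integrable.mono' h
    (Real.measurable_cos.div (measurable_id.pow_const 2)).aestronglyMeasurable ?_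
  filter_upwards [ae_restrict_mem measurableSet_Ioi] with t ht
  have ht0 : (0 : ℝ) < t := lt_trans one_pos ht
  rw [Real.norm_eq_abs, abs_div, abs_of_pos (pow_pos ht0 2), Real.rpow_neg ht0.le,
    div_eq_mul_inv]
  norm_cast
  exact mul_le_of_le_one_left (by positivity) (Real.abs_cos_le_one t)

theorem exists_tendsto_sineIntegral_atTop : ∃ l, Tendsto sineIntegral atTop (𝓝 l) := by
  refine ⟨sineIntegral 1 + (Real.cos 1 - 0 - ∫ t in Set.Ioi (1 : ℝ), Real.cos t / t ^ 2), ?_⟩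
  have h0 : Tendsto (fun r : ℝ => r⁻¹ * Real.cos r) atTop (𝓝 0) :=
    tendsto_inv_atTop_zero.zero_mul_isBoundedUnder_le
      (isBoundedUnder_of ⟨1, fun r => by simpa using Real.abs_cos_le_one r⟩)
  have h := (intervalIntegral_tendsto_integral_Ioi 1 integrableOn_cos_div_sq tendsto_id)
  refine Tendsto.congr' ?_ (tendsto_const_nhds.add ((tendsto_const_nhds.sub h0).sub h))
  filter_upwards [eventually_ge_atTop 1] with r hr using (sineIntegral_eq hr).symm

/-- The limit of the sine integral at infinity. -/
noncomputable def sineIntegralLimit : ℝ := exists_tendsto_sineIntegral_atTop.choose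

theorem tendsto_sineIntegral_atTop : Tendsto sineIntegral atTop (𝓝 sineIntegralLimit) :=
  exists_tendsto_sineIntegral_atTop.choose_spec

/-- Supplies the dominating function for the passage to the limit under the double integral. -/
theorem exists_abs_sineIntegral_le : ∃ C, ∀ r, |sineIntegral r| ≤ C := by
  obtain ⟨a, ha⟩ := eventually_atTop.1
    (tendsto_sineIntegral_atTop.abs.eventually_le_const (lt_add_one |sineIntegralLimit|))
  obtain ⟨c, hc⟩ := (isCompact_Icc (a := 0) (b := a)).exists_bound_of_continuousOn
    continuous_sineIntegral.continuousOn
  have key : ∀ r, 0 ≤ r → |sineIntegral r| ≤ max c (|sineIntegralLimit| + 1) := fun r hr => by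
    rcases le_total r a with h | h
    · exact (hc r ⟨hr, h⟩).trans (le_max_left _ _)
    · exact (ha r h).trans (le_max_right _ _)
  refine ⟨max c (|sineIntegralLimit| + 1), fun r => ?_⟩
  rcases le_total 0 r with h | h
  · exact key r h
  · simpa [sineIntegral_neg] using key (-r) (by linarith)

theorem integral_sin_mul_div {a b : ℝ} (ha : 0 < a) (hab : a ≤ b) (d : ℝ) :
    ∫ k in a..b, Real.sin (k * d) / k = sineIntegral (b * d) - sineIntegral (a * d) := by
  rcases eq_or_ne d 0 with rfl | hd
  · simp
  have hi := fun a b => Real.continuous_sinc.intervalIntegrable (μ := volume) a b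
  rw [sineIntegral, sineIntegral, intervalIntegral.integral_interval_sub_left (hi _ _) (hi _ _),
    ← intervalIntegral.mul_integral_comp_mul_right, ← intervalIntegral.integral_const_mul]
  refine intervalIntegral.integral_congr fun k hk => ?_
  rw [Set.uIcc_of_le hab] at hk
  have hk0 : k ≠ 0 := (ha.trans_le hk.1).ne'
  rw [Real.sinc_of_ne_zero (mul_ne_zero hk0 hd)]
  field_simp

/-- The lower endpoint contributes the value at 0; oddness turns the limit at infinity into a sign.
-/
theorem tendsto_sineIntegral_sub (d : ℝ) :
    Tendsto (fun n : ℕ => sineIntegral ((n + 1) * d) - sineIntegral ((n + 1 : ℝ)⁻¹ * d)) atTop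
      (𝓝 (SignType.sign d * sineIntegralLimit)) := by
  have hn : Tendsto (fun n : ℕ => (n + 1 : ℝ)) atTop atTop :=
    tendsto_atTop_add_const_right _ _ tendsto_natCast_atTop_atTop
  have h0 : Tendsto (fun n : ℕ => sineIntegral ((n + 1 : ℝ)⁻¹ * d)) atTop (𝓝 0) := by
    have := (continuous_sineIntegral.tendsto 0).comp
      (by simpa using (tendsto_inv_atTop_zero.comp hn).mul_const d)
    simpa [Function.comp_def] using this
  rw [← sub_zero (_ * _)]
  refine Tendsto.sub ?_ h0
  rcases lt_trichotomy d 0 with hd | rfl | hd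
  · have := (tendsto_sineIntegral_atTop.comp (hn.atTop_mul_const (neg_pos.2 hd))).neg
    simpa [Function.comp_def, sineIntegral_neg, sign_neg hd] using this
  · simp
  · simpa [Function.comp_def, sign_pos hd] using
      tendsto_sineIntegral_atTop.comp (hn.atTop_mul_const hd)

/-! ### The Klein-Gordon norm in momentum and position space. -/

theorem waveNorm_sq (u : ℝ → ℂ) : waveNorm u ^ 2 = ∫⁻ k, ‖u k‖ₑ ^ 2 ∂dk := by
  have := eLpNorm_nnreal_pow_eq_lintegral (f := u) (μ := dk) (p := 2) two_ne_zero
  simpa only [waveNorm, NNReal.coe_ofNat, ENNReal.rpow_ofNat, ENNReal.coe_ofNat] using this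

theorem integrable_exp_mul {x : ℝ → ℝ} (hx : Measurable x) {f : ℝ → ℂ} (hf : Integrable f)
    (k : ℝ) : Integrable fun y => Complex.exp (-(Complex.I * k * x y)) * f y := by
  refine hf.bdd_mul (c := 1) (by fun_prop) (ae_of_all _ fun y => ?_)
  simp [Complex.norm_exp]

theorem continuous_opU {x : ℝ → ℝ} (hx : Measurable x) {f : ℝ → ℂ} (hf : Integrable f) :
    Continuous (opU x f) := by
  refine continuous_const.mul (continuous_of_dominated (bound := fun y => ‖f y‖)
    (fun k => (integrable_exp_mul hx hf k).aestronglyMeasurable)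
    (fun k => ae_of_all _ fun y => ?_) hf.norm (ae_of_all _ fun y => by fun_prop))
  simp [Complex.norm_exp]

/-- Each `|U f(k)|²` is a double integral with kernel `e^{ik(x(y) - x(y'))}`; the part even in `k`
cancels in the difference and only the sine survives. -/
theorem norm_sq_opU_sub {x : ℝ → ℝ} (hx : Measurable x) {f : ℝ → ℂ} (hf : Integrable f) (k : ℝ) :
    ((‖opU x f k‖ ^ 2 - ‖opU x f (-k)‖ ^ 2 : ℝ) : ℂ) = ∫ p : ℝ × ℝ,
      Complex.I / Real.pi * (conj (f p.1) * f p.2) * (Real.sin (k * (x p.1 - x p.2)) : ℝ) := by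
  have hc : (((Real.sqrt (2 * Real.pi))⁻¹ : ℝ) : ℂ) * ((Real.sqrt (2 * Real.pi))⁻¹ : ℝ) =
      1 / (2 * Real.pi) := by
    rw [← Complex.ofReal_mul, ← mul_inv, Real.mul_self_sqrt (by positivity)]
    push_cast
    ring
  have hi : ∀ k : ℝ, Integrable fun p : ℝ × ℝ =>
      conj (Complex.exp (-(Complex.I * k * x p.1)) * f p.1) *
        (Complex.exp (-(Complex.I * k * x p.2)) * f p.2) := fun k =>
    (Integrable.mul_prod (Complex.conjLIE.toContinuousLinearEquiv.toContinuousLinearMap.integrable_comp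
      (integrable_exp_mul hx hf k)) (integrable_exp_mul hx hf k))
  have key : ∀ k : ℝ, ((‖opU x f k‖ ^ 2 : ℝ) : ℂ) = 1 / (2 * Real.pi) * ∫ p : ℝ × ℝ,
      conj (Complex.exp (-(Complex.I * k * x p.1)) * f p.1) *
        (Complex.exp (-(Complex.I * k * x p.2)) * f p.2) := fun k => by
    have h := integral_prod_mul (μ := volume) (ν := volume)
      (fun y : ℝ => conj (Complex.exp (-(Complex.I * k * x y)) * f y))
      (fun y : ℝ => Complex.exp (-(Complex.I * k * x y)) * f y)
    rw [Measure.volume_eq_prod, h, integral_conj, Complex.ofReal_pow, ← Complex.conj_mul', opU,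
      map_mul, Complex.conj_ofReal, ← hc]
    ring
  rw [Complex.ofReal_sub, key, key, ← mul_sub, ← integral_sub (hi k) (hi (-k)),
    ← integral_const_mul]
  congr 1 with p
  have e : Complex.exp (Complex.I * k * x p.1) * Complex.exp (-(Complex.I * k * x p.2)) -
      Complex.exp (-(Complex.I * k * x p.1)) * Complex.exp (Complex.I * k * x p.2) =
      2 * Complex.I * Complex.sin (k * (x p.1 - x p.2)) := by
    rw [← Complex.exp_add, ← Complex.exp_add, Complex.sin]
    ring_nf
    simp only [Complex.I_sq]
    ring_nf
  simp only [map_mul, ← Complex.exp_conj, map_neg, Complex.conj_I, Complex.conj_ofReal,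
    Complex.ofReal_sin, Complex.ofReal_mul, Complex.ofReal_sub, Complex.ofReal_neg, neg_mul,
    mul_neg, neg_neg]
  have hpi : (Real.pi : ℂ) ≠ 0 := by exact_mod_cast Real.pi_ne_zero
  linear_combination (1 / (2 * Real.pi) * conj (f p.1) * f p.2) * e

theorem integrable_conj_mul_prod {f : ℝ → ℂ} (hf : Integrable f) :
    Integrable fun p : ℝ × ℝ => conj (f p.1) * f p.2 :=
  Integrable.mul_prod
    (Complex.conjLIE.toContinuousLinearEquiv.toContinuousLinearMap.integrable_comp hf) hf

/-- Fubini: away from `k = 0` the kernel `sin(k d)/k` is bounded by `1/a`, so integrability of `f`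
suffices. -/
theorem integral_norm_sq_opU_sub {x : ℝ → ℝ} (hx : Measurable x) {f : ℝ → ℂ} (hf : Integrable f)
    {a b : ℝ} (ha : 0 < a) (hab : a ≤ b) :
    ((∫ k in a..b, (‖opU x f k‖ ^ 2 - ‖opU x f (-k)‖ ^ 2) / (2 * k) : ℝ) : ℂ) =
      ∫ p : ℝ × ℝ, Complex.I / (2 * Real.pi) * (conj (f p.1) * f p.2) *
        ((sineIntegral (b * (x p.1 - x p.2)) - sineIntegral (a * (x p.1 - x p.2)) : ℝ) : ℂ) := by
  have hint : Integrable (Function.uncurry fun (k : ℝ) (p : ℝ × ℝ) =>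
      ((Real.sin (k * (x p.1 - x p.2)) / k : ℝ) : ℂ) *
        (Complex.I / (2 * Real.pi) * (conj (f p.1) * f p.2)))
      ((volume.restrict (Set.uIoc a b)).prod volume) := by
    have : IsFiniteMeasure (volume.restrict (Set.uIoc a b)) :=
      isFiniteMeasure_restrict.2 (by rw [Set.uIoc_of_le hab]; exact measure_Ioc_lt_top.ne)
    refine Integrable.bdd_mul (c := a⁻¹) (((integrable_conj_mul_prod hf).const_mul _).comp_snd _)
      ?_ ?_
    · refine (Complex.measurable_ofReal.comp (Measurable.div ?_ measurable_fst)).aestronglyMeasurable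
      fun_prop
    · filter_upwards [Measure.quasiMeasurePreserving_fst.ae
        (ae_restrict_mem measurableSet_uIoc)] with q hq
      rw [Set.uIoc_of_le hab] at hq
      rw [Complex.norm_real, Real.norm_eq_abs, abs_div, abs_of_pos (ha.trans hq.1)]
      exact (div_le_div_of_nonneg_right (Real.abs_sin_le_one _) (ha.trans hq.1).le).trans
        (by rw [one_div]; exact inv_anti₀ ha hq.1.le)
  rw [← intervalIntegral.integral_ofReal]
  have h1 : ∀ k : ℝ, (((‖opU x f k‖ ^ 2 - ‖opU x f (-k)‖ ^ 2) / (2 * k) : ℝ) : ℂ) =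
      ∫ p : ℝ × ℝ, ((Real.sin (k * (x p.1 - x p.2)) / k : ℝ) : ℂ) *
        (Complex.I / (2 * Real.pi) * (conj (f p.1) * f p.2)) := fun k => by
    rw [Complex.ofReal_div, norm_sq_opU_sub hx hf, ← integral_div]
    congr 1 with p
    push_cast
    simp only [div_eq_mul_inv, mul_inv]
    ring
  simp_rw [h1]
  rw [intervalIntegral_integral_swap hint]
  congr 1 with p
  rw [intervalIntegral.integral_mul_const, intervalIntegral.integral_ofReal,
    integral_sin_mul_div ha hab, mul_comm]

/-- The Klein-Gordon norm in position space, `(i/2π) ∬ f(y)* f(y') sgn(y - y') dy dy'` times the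
value at infinity of the sine integral. -/
noncomputable def kleinGordonNorm (f : ℝ → ℂ) : ℂ :=
  ∫ p : ℝ × ℝ, Complex.I / (2 * Real.pi) * (conj (f p.1) * f p.2) *
    (((SignType.sign (p.1 - p.2) : ℝ) * sineIntegralLimit : ℝ) : ℂ)

theorem tendsto_integral_norm_sq_opU_sub {x : ℝ → ℝ} (hx : StrictMono x) {f : ℝ → ℂ}
    (hf : Integrable f) :
    Tendsto (fun n : ℕ => ∫ k in (n + 1 : ℝ)⁻¹..(n + 1),
      (‖opU x f k‖ ^ 2 - ‖opU x f (-k)‖ ^ 2) / (2 * k)) atTop (𝓝 (kleinGordonNorm f).re) := by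
  have hxm := hx.monotone.measurable
  obtain ⟨C, hC⟩ := exists_abs_sineIntegral_le
  suffices h : Tendsto (fun n : ℕ => ((∫ k in (n + 1 : ℝ)⁻¹..(n + 1),
      (‖opU x f k‖ ^ 2 - ‖opU x f (-k)‖ ^ 2) / (2 * k) : ℝ) : ℂ)) atTop
      (𝓝 (kleinGordonNorm f)) from (Complex.continuous_re.tendsto _).comp h
  have hn : ∀ n : ℕ, (n + 1 : ℝ)⁻¹ ≤ n + 1 := fun n =>
    (inv_le_one_of_one_le₀ (by simp)).trans (by simp)
  simp_rw [fun n : ℕ => integral_norm_sq_opU_sub hxm hf (a := (n + 1 : ℝ)⁻¹) (b := n + 1)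
    (by positivity) (hn n)]
  have hF := (integrable_conj_mul_prod hf).const_mul (Complex.I / (2 * Real.pi))
  have hS := continuous_sineIntegral.measurable
  refine tendsto_integral_of_dominated_convergence
    (fun p => ‖Complex.I / (2 * Real.pi) * (conj (f p.1) * f p.2)‖ * (C + C))
    (fun n => hF.aestronglyMeasurable.mul (by fun_prop)) (hF.norm.mul_const _)
    (fun n => ae_of_all _ fun p => ?_) (ae_of_all _ fun p => ?_)
  · rw [norm_mul, Complex.norm_real, Real.norm_eq_abs]
    exact mul_le_mul_of_nonneg_left
      ((abs_sub _ _).trans (add_le_add (hC _) (hC _))) (norm_nonneg _)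
  · refine tendsto_const_nhds.mul ((Complex.continuous_ofReal.tendsto _).comp ?_)
    -- The only step that uses more about `x` than measurability: an increasing map preserves the
    -- order of the two points, whatever its range.
    have hs : SignType.sign (p.1 - p.2) = SignType.sign (x p.1 - x p.2) := by
      rcases lt_trichotomy p.1 p.2 with h | h | h
      · rw [sign_neg (sub_neg.2 h), sign_neg (sub_neg.2 (hx h))]
      · simp [h]
      · rw [sign_pos (sub_pos.2 h), sign_pos (sub_pos.2 (hx h))]
    rw [hs]
    exact tendsto_sineIntegral_sub _

/-! ### Exhaustion of the half-line by momentum shells. -/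

/-- The momenta between `1/(n+1)` and `n+1`. -/
def momentumShell (n : ℕ) : Set ℝ := Set.Ioc (n + 1 : ℝ)⁻¹ (n + 1)

theorem momentumShell_subset (n : ℕ) : momentumShell n ⊆ Set.Ioi 0 := fun k hk =>
  lt_trans (by positivity) hk.1

theorem monotone_momentumShell : Monotone momentumShell := fun m n h =>
  Set.Ioc_subset_Ioc (inv_anti₀ (by positivity) (by gcongr)) (by gcongr)

theorem iUnion_momentumShell : ⋃ n, momentumShell n = Set.Ioi 0 := by
  refine Set.Subset.antisymm (Set.iUnion_subset momentumShell_subset) fun k (hk : 0 < k) => ?_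
  obtain ⟨n, hn⟩ := exists_nat_gt (max k k⁻¹)
  refine Set.mem_iUnion.2 ⟨n, ?_, ?_⟩
  · exact inv_lt_of_inv_lt₀ hk (by linarith [le_max_right k k⁻¹])
  · linarith [le_max_left k k⁻¹]

theorem ae_dk_pos : ∀ᵐ k ∂dk, 0 < k :=
  (withDensity_absolutelyContinuous _ _).ae_le (ae_restrict_mem measurableSet_Ioi)

theorem tendsto_setLIntegral_momentumShell (F : ℝ → ℝ≥0∞) :
    Tendsto (fun n => ∫⁻ k in momentumShell n, F k ∂dk) atTop (𝓝 (∫⁻ k, F k ∂dk)) := by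
  have h := setLIntegral_iUnion_of_directed (μ := dk) F monotone_momentumShell.directed_le
  rw [iUnion_momentumShell,
    Measure.restrict_eq_self_of_ae_mem (s := Set.Ioi (0 : ℝ)) ae_dk_pos] at h
  rw [h]
  exact tendsto_atTop_iSup fun m n hmn => lintegral_mono_set (monotone_momentumShell hmn)

theorem integrableOn_norm_sq_div {u : ℝ → ℂ} (hu : Continuous u) (n : ℕ) :
    IntegrableOn (fun k => ‖u k‖ ^ 2 / (2 * k)) (momentumShell n) := by
  refine (ContinuousOn.integrableOn_Icc ?_).mono_set Set.Ioc_subset_Icc_self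
  refine ContinuousOn.div (by fun_prop) (by fun_prop) fun k hk => ?_
  have : 0 < k := lt_of_lt_of_le (by positivity) hk.1
  positivity

/-- On a shell the integral is finite, so the two sides of the conservation law can be subtracted as
real numbers before the limit in `[0, ∞]`. -/
theorem setLIntegral_momentumShell {u : ℝ → ℂ} (hu : Continuous u) (n : ℕ) :
    ∫⁻ k in momentumShell n, ‖u k‖ₑ ^ 2 ∂dk =
      ENNReal.ofReal (∫ k in momentumShell n, ‖u k‖ ^ 2 / (2 * k)) := by
  have hm : MeasurableSet (momentumShell n) := measurableSet_Ioc
  rw [dk, restrict_withDensity hm, Measure.restrict_restrict hm,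
    Set.inter_eq_left.2 (momentumShell_subset n),
    lintegral_withDensity_eq_lintegral_mul _ (by fun_prop) (by fun_prop),
    ofReal_integral_eq_lintegral_ofReal (integrableOn_norm_sq_div hu n)]
  · refine setLIntegral_congr_fun hm fun k hk => ?_
    have hk0 : 0 < k := momentumShell_subset n hk
    simp only [Pi.mul_apply]
    rw [← ofReal_norm, ← ENNReal.ofReal_pow (norm_nonneg _),
      ← ENNReal.ofReal_mul (by positivity)]
    congr 1
    ring
  · filter_upwards [ae_restrict_mem hm] with k hk
    have hk0 : 0 < k := momentumShell_subset n hk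
    simp only [Pi.zero_apply]
    positivity

theorem tendsto_momentumShell_sub {x : ℝ → ℝ} (hx : StrictMono x) {f : ℝ → ℂ}
    (hf : Integrable f) :
    Tendsto (fun n : ℕ => (∫ k in momentumShell n, ‖opU x f k‖ ^ 2 / (2 * k)) -
      ∫ k in momentumShell n, ‖opU x f (-k)‖ ^ 2 / (2 * k)) atTop
      (𝓝 (kleinGordonNorm f).re) := by
  have hc := continuous_opU hx.monotone.measurable hf
  refine (tendsto_integral_norm_sq_opU_sub hx hf).congr fun n => ?_
  have hn : (n + 1 : ℝ)⁻¹ ≤ n + 1 :=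
    (inv_le_one_of_one_le₀ (by simp)).trans (by simp)
  rw [← integral_sub (integrableOn_norm_sq_div hc n)
    (integrableOn_norm_sq_div (u := fun k => opU x f (-k)) (hc.comp continuous_neg) n),
    intervalIntegral.integral_of_le hn, momentumShell]
  simp only [sub_div]

/-! ### Conservation of the Klein-Gordon norm. -/

theorem opU_id (f : ℝ → ℂ) : opU id f = momentum f := rfl

/-- The limit formula is evaluated at `x = id`, where the negative-momentum term vanishes and the
positive one is the normalization of `f`. -/
theorem kleinGordonNorm_re {f : ℝ → ℂ} (hf : IsOutgoingWave f) : (kleinGordonNorm f).re = 1 := by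
  have h := tendsto_momentumShell_sub strictMono_id hf.integrable
  rw [opU_id] at h
  have hc : Continuous (momentum f) := continuous_opU measurable_id hf.integrable
  have h0 : ∀ n, ∫ k in momentumShell n, ‖momentum f (-k)‖ ^ 2 / (2 * k) = 0 := fun n => by
    refine setIntegral_eq_zero_of_forall_eq_zero fun k hk => ?_
    simp [hf.momentum_neg (-k) (neg_neg_of_pos (momentumShell_subset n hk))]
  simp only [h0, sub_zero] at h
  have h1 := (ENNReal.continuous_ofReal.tendsto _).comp h
  simp only [Function.comp_def, ← setLIntegral_momentumShell hc] at h1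
  have h2 := tendsto_nhds_unique h1 (tendsto_setLIntegral_momentumShell _)
  rw [← waveNorm_sq, hf.normalized.2, one_pow, ENNReal.ofReal_eq_one] at h2
  exact h2

theorem waveNorm_opA_sq (x : ℝ → ℝ) (f : ℝ → ℂ) :
    waveNorm (opA x f) ^ 2 = ∫⁻ k, ‖opU x f k‖ₑ ^ 2 ∂dk := by
  rw [waveNorm_sq]
  refine lintegral_congr_ae (ae_dk_pos.mono fun k hk => ?_)
  simp [opA, hk]

theorem waveNorm_opB_sq (x : ℝ → ℝ) (f : ℝ → ℂ) :
    waveNorm (opB x f) ^ 2 = ∫⁻ k, ‖opU x f (-k)‖ₑ ^ 2 ∂dk := by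
  rw [waveNorm_sq]
  refine lintegral_congr_ae (ae_dk_pos.mono fun k hk => ?_)
  simp [opB, hk]

/-- Bounds on `‖A f‖²` in `[0, ∞]`, from the invariance of the Klein-Gordon norm under the
coordinate transformation. -/
theorem waveNorm_opA_sq_bounds {x : ℝ → ℝ} (hx : StrictMono x) {f : ℝ → ℂ}
    (hf : IsOutgoingWave f) :
    1 ≤ waveNorm (opA x f) ^ 2 ∧
      waveNorm (opA x f) ^ 2 ≤ 1 + waveNorm (opB x f) ^ 2 := by
  have hc := continuous_opU hx.monotone.measurable hf.integrable
  have hc' : Continuous fun k => opU x f (-k) := hc.comp continuous_neg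
  have h := (ENNReal.continuous_ofReal.tendsto _).comp
    (tendsto_momentumShell_sub hx hf.integrable)
  rw [kleinGordonNorm_re hf, ENNReal.ofReal_one] at h
  have hA := tendsto_setLIntegral_momentumShell fun k => ‖opU x f k‖ₑ ^ 2
  have hB := tendsto_setLIntegral_momentumShell fun k => ‖opU x f (-k)‖ₑ ^ 2
  rw [← waveNorm_opA_sq] at hA
  rw [← waveNorm_opB_sq] at hB
  have hnn : ∀ n, 0 ≤ ∫ k in momentumShell n, ‖opU x f (-k)‖ ^ 2 / (2 * k) := fun n =>
    setIntegral_nonneg measurableSet_Ioc fun k hk => by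
      have : 0 < k := momentumShell_subset n hk
      positivity
  -- With `a`, `b` the shell integrals at positive and negative momenta, `a - b → 1`. The claims are
  -- the limits of `a - b ≤ a` and `a ≤ (a - b) + b`, which make sense even when `a` and `b`
  -- diverge.
  refine ⟨le_of_tendsto_of_tendsto' h hA fun n => ?_,
    le_of_tendsto_of_tendsto' hA (h.add hB) fun n => ?_⟩
  · rw [setLIntegral_momentumShell hc]
    exact ENNReal.ofReal_le_ofReal (sub_le_self _ (hnn n))
  · rw [setLIntegral_momentumShell hc, setLIntegral_momentumShell hc']
    refine le_trans (ENNReal.ofReal_le_ofReal ?_) ENNReal.ofReal_add_le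
    simp

/-! ### Norm bounds for symmetrized two-particle functions. -/

section Symmetrization

variable {α : Type*} [MeasurableSpace α] {μ : Measure α}

theorem lintegral_enorm_sq_eq_ofReal {u : α → ℂ} (h : Integrable (fun a => ‖u a‖ ^ 2) μ) :
    ∫⁻ a, ‖u a‖ₑ ^ 2 ∂μ = ENNReal.ofReal (∫ a, ‖u a‖ ^ 2 ∂μ) := by
  rw [ofReal_integral_eq_lintegral_ofReal h (ae_of_all _ fun a => by positivity)]
  simp only [← ofReal_norm, ENNReal.ofReal_pow (norm_nonneg _)]

theorem lintegral_symmetrization_le [SFinite μ] {β γ : α → ℂ} (hβ : AEStronglyMeasurable β μ)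
    (hγ : AEStronglyMeasurable γ μ) :
    ∫⁻ p, ‖β p.1 * γ p.2 + β p.2 * γ p.1‖ₑ ^ 2 ∂(μ.prod μ) ≤
      4 * ((∫⁻ a, ‖β a‖ₑ ^ 2 ∂μ) * ∫⁻ a, ‖γ a‖ₑ ^ 2 ∂μ) := by
  have hβ' : AEMeasurable (fun a => ‖β a‖ₑ ^ 2) μ := hβ.enorm.pow_const 2
  have hγ' : AEMeasurable (fun a => ‖γ a‖ₑ ^ 2) μ := hγ.enorm.pow_const 2
  have hp : ∀ p : α × α, ‖β p.1 * γ p.2 + β p.2 * γ p.1‖ₑ ^ 2 ≤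
      2 * (‖β p.1‖ₑ ^ 2 * ‖γ p.2‖ₑ ^ 2 + ‖γ p.1‖ₑ ^ 2 * ‖β p.2‖ₑ ^ 2) := fun p => by
    -- Convexity of the square, `(s + t)² ≤ 2(s² + t²)`.
    have h := ENNReal.rpow_add_le_mul_rpow_add_rpow (‖β p.1 * γ p.2‖ₑ) (‖β p.2 * γ p.1‖ₑ)
      (p := 2) one_le_two
    norm_num [-enorm_mul] at h
    refine (pow_le_pow_left₀ zero_le (enorm_add_le _ _) 2).trans (h.trans_eq ?_)
    simp only [enorm_mul]
    ring
  refine (lintegral_mono hp).trans_eq ?_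
  rw [lintegral_const_mul' _ _ ENNReal.ofNat_ne_top,
    lintegral_add_left' (f := fun p : α × α => ‖β p.1‖ₑ ^ 2 * ‖γ p.2‖ₑ ^ 2)
      (hβ'.comp_fst.mul hγ'.comp_snd), lintegral_prod_mul hβ' hγ',
    lintegral_prod_mul hγ' hβ']
  ring

/-- The cross term integrates to `2|∫ β γ*|²`, which is nonnegative: the plus sign of Bose
symmetrization is what makes the bound hold. -/
theorem le_lintegral_symmetrization_of_memLp [SFinite μ] {β γ : α → ℂ} (hβ : MemLp β 2 μ)
    (hγ : MemLp γ 2 μ) :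
    2 * ((∫⁻ a, ‖β a‖ₑ ^ 2 ∂μ) * ∫⁻ a, ‖γ a‖ₑ ^ 2 ∂μ) ≤
      ∫⁻ p, ‖β p.1 * γ p.2 + β p.2 * γ p.1‖ₑ ^ 2 ∂(μ.prod μ) := by
  have hβ2 : Integrable (fun a => ‖β a‖ ^ 2) μ := (memLp_two_iff_integrable_sq_norm hβ.1).1 hβ
  have hγ2 : Integrable (fun a => ‖γ a‖ ^ 2) μ := (memLp_two_iff_integrable_sq_norm hγ.1).1 hγ
  have hβγ : Integrable (fun a => β a * conj (γ a)) μ := hβ.integrable_mul hγ.star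
  have hγβ : Integrable (fun a => γ a * conj (β a)) μ := hγ.integrable_mul hβ.star
  have hcross := hβγ.mul_prod hγβ
  have h1 := hβ2.mul_prod hγ2
  have h2 := hγ2.mul_prod hβ2
  have e : ∀ p : α × α, ‖β p.1 * γ p.2 + β p.2 * γ p.1‖ ^ 2 =
      (‖β p.1‖ ^ 2 * ‖γ p.2‖ ^ 2 + ‖γ p.1‖ ^ 2 * ‖β p.2‖ ^ 2) +
        2 * (β p.1 * conj (γ p.1) * (γ p.2 * conj (β p.2))).re := fun p => by
    rw [← Complex.normSq_eq_norm_sq, Complex.normSq_add, Complex.normSq_mul, Complex.normSq_mul]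
    simp only [Complex.normSq_eq_norm_sq, map_mul]
    ring_nf
  have hint : Integrable (fun p : α × α => ‖β p.1 * γ p.2 + β p.2 * γ p.1‖ ^ 2) (μ.prod μ) := by
    simp_rw [e]
    exact (h1.add h2).add (hcross.re.const_mul 2)
  rw [lintegral_enorm_sq_eq_ofReal hint, lintegral_enorm_sq_eq_ofReal hβ2,
    lintegral_enorm_sq_eq_ofReal hγ2, ← ENNReal.ofReal_mul (by positivity),
    ← ENNReal.ofReal_ofNat, ← ENNReal.ofReal_mul (by positivity)]
  refine ENNReal.ofReal_le_ofReal ?_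
  have hc : 0 ≤ ∫ p : α × α, (β p.1 * conj (γ p.1) * (γ p.2 * conj (β p.2))).re ∂(μ.prod μ) := by
    have h := integral_re hcross
    simp only [RCLike.re_to_complex] at h
    rw [h, integral_prod_mul (fun a => β a * conj (γ a)) fun a => γ a * conj (β a)]
    have hconj : ∫ a, γ a * conj (β a) ∂μ = conj (∫ a, β a * conj (γ a) ∂μ) := by
      rw [← integral_conj]
      simp only [map_mul, Complex.conj_conj, mul_comm]
    rw [hconj, Complex.mul_conj, Complex.ofReal_re]
    exact Complex.normSq_nonneg _
  have hsum : ∫ p, ‖β p.1 * γ p.2 + β p.2 * γ p.1‖ ^ 2 ∂(μ.prod μ) =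
      2 * ((∫ a, ‖β a‖ ^ 2 ∂μ) * ∫ a, ‖γ a‖ ^ 2 ∂μ) +
        2 * ∫ p : α × α, (β p.1 * conj (γ p.1) * (γ p.2 * conj (β p.2))).re ∂(μ.prod μ) := by
    simp_rw [e]
    have hre : Integrable (fun p : α × α =>
        (β p.1 * conj (γ p.1) * (γ p.2 * conj (β p.2))).re) (μ.prod μ) := hcross.re
    rw [integral_add (f := fun p : α × α => ‖β p.1‖ ^ 2 * ‖γ p.2‖ ^ 2 + ‖γ p.1‖ ^ 2 * ‖β p.2‖ ^ 2)
      (h1.add h2) (hre.const_mul 2), integral_const_mul]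
    congr 1
    rw [integral_add h1 h2,
      integral_prod_mul (fun a => ‖β a‖ ^ 2) fun a => ‖γ a‖ ^ 2,
      integral_prod_mul (fun a => ‖γ a‖ ^ 2) fun a => ‖β a‖ ^ 2]
    ring
  rw [hsum]
  linarith

/-- Here `β` need not be square integrable. The previous bound applies on sets of finite measure
where `β` is bounded, and these exhaust the space. -/
theorem le_lintegral_symmetrization [SigmaFinite μ] {β γ : α → ℂ} (hβ : StronglyMeasurable β)
    (hγ : MemLp γ 2 μ) (hγ1 : ∫⁻ a, ‖γ a‖ₑ ^ 2 ∂μ = 1) :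
    2 * ∫⁻ a, ‖β a‖ₑ ^ 2 ∂μ ≤
      ∫⁻ p, ‖β p.1 * γ p.2 + β p.2 * γ p.1‖ₑ ^ 2 ∂(μ.prod μ) := by
  set S : ℕ → Set α := fun n => spanningSets μ n ∩ {a | ‖β a‖ ≤ n} with hS
  have hSmono : Monotone S := fun m n hmn =>
    Set.inter_subset_inter (monotone_spanningSets μ hmn)
      fun a (ha : ‖β a‖ ≤ m) => ha.trans (by exact_mod_cast hmn)
  have hSuniv : ⋃ n, S n = Set.univ := by
    refine Set.eq_univ_of_forall fun a => ?_
    obtain ⟨n, hn⟩ := exists_nat_ge ‖β a‖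
    refine Set.mem_iUnion.2 ⟨max n (spanningSetsIndex μ a), ?_, ?_⟩
    · exact monotone_spanningSets μ (le_max_right _ _) (mem_spanningSetsIndex μ a)
    · exact hn.trans (by exact_mod_cast le_max_left _ _)
  have hlim : ∀ F : α → ℝ≥0∞,
      Tendsto (fun n => ∫⁻ a in S n, F a ∂μ) atTop (𝓝 (∫⁻ a, F a ∂μ)) := fun F => by
    have h := setLIntegral_iUnion_of_directed (μ := μ) F hSmono.directed_le
    rw [hSuniv, Measure.restrict_univ] at h
    rw [h]
    exact tendsto_atTop_iSup fun m n hmn => lintegral_mono_set (hSmono hmn)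
  have hγlim := hlim fun a => ‖γ a‖ₑ ^ 2
  rw [hγ1] at hγlim
  -- The `γ` factor tends to 1, neither 0 nor `∞`, so the product converges even if `∫ |β|²` is
  -- infinite.
  have h := ENNReal.Tendsto.const_mul (a := 2) (ENNReal.Tendsto.mul (hlim fun a => ‖β a‖ₑ ^ 2)
    (Or.inr ENNReal.one_ne_top) hγlim (Or.inl one_ne_zero)) (Or.inr ENNReal.ofNat_ne_top)
  rw [mul_one] at h
  refine le_of_tendsto' h fun n => ?_
  have hfin : IsFiniteMeasure (μ.restrict (S n)) := isFiniteMeasure_restrict.2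
    ((measure_mono Set.inter_subset_left).trans_lt (measure_spanningSets_lt_top μ n)).ne
  have hSm : MeasurableSet (S n) := (measurableSet_spanningSets μ n).inter
    (measurableSet_le hβ.norm.measurable measurable_const)
  refine (le_lintegral_symmetrization_of_memLp (μ := μ.restrict (S n)) ?_ (hγ.restrict _)).trans ?_
  · refine MemLp.of_bound hβ.aestronglyMeasurable n ?_
    filter_upwards [ae_restrict_mem hSm] with a ha using ha.2
  · rw [Measure.prod_restrict]
    exact setLIntegral_le_lintegral _ _

end Symmetrization

/-! ### Action of the field on the vacuum and on one-particle vectors. -/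

instance : SigmaFinite dk := by unfold dk; infer_instance

theorem lintegral_pi_fin_zero (F : (Fin 0 → ℝ) → ℝ≥0∞) (c : Fin 0 → ℝ) :
    ∫⁻ k, F k ∂(Measure.pi fun _ : Fin 0 => dk) = F c := by
  rw [Measure.pi_of_empty _ c, lintegral_dirac]

theorem lintegral_pi_fin_one (F : ℝ → ℝ≥0∞) :
    ∫⁻ k, F (k 0) ∂(Measure.pi fun _ : Fin 1 => dk) = ∫⁻ q, F q ∂dk :=
  ((measurePreserving_funUnique dk (Fin 1)).lintegral_map_equiv F
    (MeasurableEquiv.funUnique (Fin 1) ℝ)).symm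

theorem lintegral_pi_fin_two (F : ℝ × ℝ → ℝ≥0∞) :
    ∫⁻ k, F (k 0, k 1) ∂(Measure.pi fun _ : Fin 2 => dk) = ∫⁻ p, F p ∂(dk.prod dk) :=
  ((measurePreserving_finTwoArrow dk).lintegral_map_equiv F MeasurableEquiv.finTwoArrow).symm

theorem inField_vacuum_one (H : ℝ → ℂ) (k : Fin 1 → ℝ) : inField H vacuum 1 k = H (-k 0) := by
  simp [inField, annihilate, create, vacuum]

theorem inField_vacuum_of_ne_one (H : ℝ → ℂ) {n : ℕ} (hn : n ≠ 1) (k : Fin n → ℝ) :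
    inField H vacuum n k = 0 := by
  match n, hn with
  | 0, _ => simp [inField, annihilate, create, vacuum]
  | n + 2, _ => simp [inField, annihilate, create, vacuum]

theorem fockNormSq_inField_vacuum (H : ℝ → ℂ) :
    fockNormSq (inField H vacuum) = ∫⁻ q, ‖H (-q)‖ₑ ^ 2 ∂dk := by
  rw [fockNormSq, tsum_eq_single 1]
  · simp_rw [inField_vacuum_one]
    exact lintegral_pi_fin_one fun q => ‖H (-q)‖ₑ ^ 2
  · intro n hn
    simp [inField_vacuum_of_ne_one H hn]

/-- Annihilation yields the zero-particle component and creation the two-particle one; `2⁻¹` is the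
square of the normalization in `create`. -/
theorem fockNormSq_inField_of_oneParticle (H γ : ℝ → ℂ) {Ψ : FockVector}
    (h1 : ∀ k, Ψ 1 k = γ (k 0)) (h : ∀ n ≠ 1, ∀ k, Ψ n k = 0) :
    fockNormSq (inField H Ψ) = ‖∫ q, H q * γ q ∂dk‖ₑ ^ 2 +
      2⁻¹ * ∫⁻ p, ‖H (-p.1) * γ p.2 + H (-p.2) * γ p.1‖ₑ ^ 2 ∂(dk.prod dk) := by
  have e0 : ∀ k, inField H Ψ 0 k = ∫ q, H q * γ q ∂dk := fun k => by
    simp [inField, annihilate, create, h1]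
  have e1 : ∀ k, inField H Ψ 1 k = 0 := fun k => by
    simp [inField, annihilate, create, h]
  have e2 : ∀ k, inField H Ψ 2 k =
      ((Real.sqrt 2)⁻¹ : ℝ) * (H (-k 0) * γ (k 1) + H (-k 1) * γ (k 0)) := fun k => by
    simp [inField, annihilate, create, h, h1, Fin.sum_univ_two, one_add_one_eq_two]
  have e3 : ∀ n k, inField H Ψ (n + 3) k = 0 := fun n k => by
    simp [inField, annihilate, create, h]
  have hs : ‖(((Real.sqrt 2)⁻¹ : ℝ) : ℂ)‖ₑ ^ 2 = 2⁻¹ := by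
    rw [← ofReal_norm, Complex.norm_real, ← ENNReal.ofReal_pow (norm_nonneg _), Real.norm_eq_abs,
      sq_abs, inv_pow, Real.sq_sqrt zero_le_two, ENNReal.ofReal_inv_of_pos two_pos,
      ENNReal.ofReal_ofNat]
  rw [fockNormSq, tsum_eq_sum (s := {0, 2})]
  · rw [Finset.sum_pair (by norm_num)]
    congr 1
    · rw [lintegral_pi_fin_zero _ 0, e0]
    · simp_rw [e2, enorm_mul, mul_pow, hs]
      rw [lintegral_const_mul' _ _ (by simp)]
      congr 1
      exact lintegral_pi_fin_two fun p => ‖H (-p.1) * γ p.2 + H (-p.2) * γ p.1‖ₑ ^ 2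
  · intro n hn
    match n, hn with
    | 0, hn => simp at hn
    | 1, _ => simp [e1]
    | 2, hn => simp at hn
    | n + 3, _ => simp [e3]

theorem spontaneousNumber_eq (x : ℝ → ℝ) (f : ℝ → ℂ) :
    spontaneousNumber x f = waveNorm (opB x f) ^ 2 := by
  rw [spontaneousNumber, meanNumber, outField, fockNormSq_inField_vacuum, waveNorm_opB_sq]

theorem stimulatedNumber_eq (x : ℝ → ℝ) (g f : ℝ → ℂ) :
    stimulatedNumber x g f = ‖∫ q, opU x f q * conj (g q) ∂dk‖ₑ ^ 2 +
      2⁻¹ * ∫⁻ p, ‖opU x f (-p.1) * conj (g p.2) + opU x f (-p.2) * conj (g p.1)‖ₑ ^ 2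
        ∂(dk.prod dk) := by
  rw [stimulatedNumber, meanNumber, outField, fockNormSq_inField_of_oneParticle (opU x f)
    -- The sign flips of the adjoint and of creation cancel, leaving the wave function `g*`. The
    -- cutoff at 0 is invisible to `dk`.
    (fun q => conj (if 0 < q then g q else 0)) (Ψ := oneParticle g)
    (fun k => by rw [oneParticle, inFieldAdj, inField_vacuum_one, neg_neg])
    (fun n hn k => inField_vacuum_of_ne_one _ hn k)]
  congr 2
  · congr 1
    refine integral_congr_ae (ae_dk_pos.mono fun q hq => ?_)
    simp [hq]
  · refine lintegral_congr_ae ?_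
    filter_upwards [Measure.quasiMeasurePreserving_fst.ae ae_dk_pos,
      Measure.quasiMeasurePreserving_snd.ae ae_dk_pos] with p h1 h2
    simp [h1, h2]

/-! ### Bounds on the stimulated number. -/

theorem IsNormalizedWave.lintegral_eq_one {g : ℝ → ℂ} (hg : IsNormalizedWave g) :
    ∫⁻ k, ‖g k‖ₑ ^ 2 ∂dk = 1 := by
  rw [← waveNorm_sq, hg.2, one_pow]

/-- Cauchy–Schwarz in `[0, ∞]`, so that `u` may have infinite norm. -/
theorem enorm_integral_mul_conj_sq_le {u g : ℝ → ℂ} (hu : AEStronglyMeasurable u dk)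
    (hg : AEStronglyMeasurable g dk) :
    ‖∫ q, u q * conj (g q) ∂dk‖ₑ ^ 2 ≤ (∫⁻ q, ‖u q‖ₑ ^ 2 ∂dk) * ∫⁻ q, ‖g q‖ₑ ^ 2 ∂dk := by
  have h := ENNReal.lintegral_mul_le_Lp_mul_Lq dk Real.HolderConjugate.two_two hu.enorm hg.enorm
  have h1 : ‖∫ q, u q * conj (g q) ∂dk‖ₑ ≤ ∫⁻ q, ‖u q‖ₑ * ‖g q‖ₑ ∂dk :=
    (enorm_integral_le_lintegral_enorm _).trans_eq (by simp [enorm_mul])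
  refine (pow_le_pow_left₀ zero_le (h1.trans h) 2).trans_eq ?_
  rw [mul_pow, ← ENNReal.rpow_ofNat, ← ENNReal.rpow_ofNat, ← ENNReal.rpow_mul, ← ENNReal.rpow_mul]
  norm_num

/-- Serves both lower bounds: the pairing term is dropped for general `g` and equals `‖A f‖²` for
the classical wave. -/
theorem spontaneousNumber_add_le_stimulatedNumber {x : ℝ → ℝ} (hx : StrictMono x) {f g : ℝ → ℂ}
    (hf : Integrable f) (hg : IsNormalizedWave g) :
    ‖∫ q, opU x f q * conj (g q) ∂dk‖ₑ ^ 2 + spontaneousNumber x f ≤ stimulatedNumber x g f := by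
  have hc := continuous_opU hx.monotone.measurable hf
  have hγ1 : ∫⁻ k, ‖conj (g k)‖ₑ ^ 2 ∂dk = 1 := by simpa using hg.lintegral_eq_one
  have h := le_lintegral_symmetrization (β := fun k => opU x f (-k))
    (hc.comp continuous_neg).stronglyMeasurable hg.1.star hγ1
  rw [stimulatedNumber_eq, spontaneousNumber_eq, waveNorm_opB_sq]
  refine add_le_add_right ?_ _
  rw [mul_comm, ← div_eq_mul_inv, ENNReal.le_div_iff_mul_le (by simp) (by simp), mul_comm]
  exact h

/-- The constant is `3 = 1 + 2`: one `‖B f‖²` from `‖A f‖² ≤ 1 + ‖B f‖²`, two from the symmetrized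
product. -/
theorem stimulatedNumber_le {x : ℝ → ℝ} (hx : StrictMono x) {f g : ℝ → ℂ}
    (hf : IsOutgoingWave f) (hg : IsNormalizedWave g) :
    stimulatedNumber x g f ≤ 1 + 3 * spontaneousNumber x f := by
  have hc := continuous_opU hx.monotone.measurable hf.integrable
  have hγ1 : ∫⁻ k, ‖conj (g k)‖ₑ ^ 2 ∂dk = 1 := by simpa using hg.lintegral_eq_one
  have h1 := enorm_integral_mul_conj_sq_le (u := opU x f) hc.aestronglyMeasurable hg.1.1
  have h2 := lintegral_symmetrization_le (μ := dk) (β := fun k => opU x f (-k))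
    (hc.comp continuous_neg).aestronglyMeasurable hg.1.star.1
  rw [hg.lintegral_eq_one, mul_one, ← waveNorm_opA_sq] at h1
  simp only [Pi.star_apply, RCLike.star_def] at h2
  rw [hγ1, mul_one, ← waveNorm_opB_sq] at h2
  rw [stimulatedNumber_eq, spontaneousNumber_eq]
  calc _ ≤ (1 + waveNorm (opB x f) ^ 2) + 2⁻¹ * (4 * waveNorm (opB x f) ^ 2) :=
        add_le_add (h1.trans (waveNorm_opA_sq_bounds hx hf).2) (mul_le_mul_right h2 _)
    _ = (1 + waveNorm (opB x f) ^ 2) + 2 * waveNorm (opB x f) ^ 2 := by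
        rw [← mul_assoc, (by norm_num : (4 : ℝ≥0∞) = 2 * 2), ← mul_assoc,
          ENNReal.inv_mul_cancel two_ne_zero ENNReal.ofNat_ne_top, one_mul]
    _ = 1 + 3 * waveNorm (opB x f) ^ 2 := by ring

theorem measurable_opA {x : ℝ → ℝ} (hx : StrictMono x) {f : ℝ → ℂ} (hf : Integrable f) :
    Measurable (opA x f) :=
  Measurable.ite measurableSet_Ioi (continuous_opU hx.monotone.measurable hf).measurable
    measurable_const

theorem isNormalizedWave_classicalWave {x : ℝ → ℝ} (hx : StrictMono x) {f : ℝ → ℂ}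
    (hf : Integrable f) (h0 : waveNorm (opA x f) ≠ 0) (ht : waveNorm (opA x f) ≠ ∞) :
    IsNormalizedWave (classicalWave x f) := by
  have hA : MemLp (opA x f) 2 dk :=
    ⟨(measurable_opA hx hf).aestronglyMeasurable, lt_top_iff_ne_top.2 ht⟩
  refine ⟨hA.const_mul _, ?_⟩
  have h := eLpNorm_const_smul (((waveNorm (opA x f)).toReal⁻¹ : ℝ) : ℂ) (opA x f) 2 dk
  have hn : ‖(((waveNorm (opA x f)).toReal⁻¹ : ℝ) : ℂ)‖ₑ = (waveNorm (opA x f))⁻¹ := by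
    rw [← ofReal_norm, Complex.norm_real, Real.norm_of_nonneg (by positivity),
      ENNReal.ofReal_inv_of_pos (ENNReal.toReal_pos h0 ht), ENNReal.ofReal_toReal ht]
  rw [hn] at h
  exact h.trans (ENNReal.inv_mul_cancel h0 ht)

/-- The equality case of Cauchy–Schwarz: the integrand is `|A f|²/‖A f‖`. -/
theorem integral_opU_mul_conj_classicalWave {x : ℝ → ℝ} (hx : StrictMono x) {f : ℝ → ℂ}
    (hf : Integrable f) (h0 : waveNorm (opA x f) ≠ 0) (ht : waveNorm (opA x f) ≠ ∞) :
    ∫ q, opU x f q * conj (classicalWave x f q) ∂dk = ((waveNorm (opA x f)).toReal : ℂ) := by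
  set N := (waveNorm (opA x f)).toReal with hN
  have hN0 : N ≠ 0 := (ENNReal.toReal_pos h0 ht).ne'
  have hA : MemLp (opA x f) 2 dk :=
    ⟨(measurable_opA hx hf).aestronglyMeasurable, lt_top_iff_ne_top.2 ht⟩
  have hA2 : Integrable (fun k => ‖opA x f k‖ ^ 2) dk :=
    (memLp_two_iff_integrable_sq_norm hA.1).1 hA
  have hsq : ∫ k, ‖opA x f k‖ ^ 2 ∂dk = N ^ 2 := by
    rw [hN, ← ENNReal.toReal_pow, waveNorm_sq, lintegral_enorm_sq_eq_ofReal hA2,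
      ENNReal.toReal_ofReal (integral_nonneg fun k => by positivity)]
  have e : ∫ q, opU x f q * conj (classicalWave x f q) ∂dk =
      ∫ q, ((N⁻¹ * ‖opA x f q‖ ^ 2 : ℝ) : ℂ) ∂dk := by
    refine integral_congr_ae (ae_dk_pos.mono fun q hq => ?_)
    have hU : opU x f q = opA x f q := by simp [opA, hq]
    simp only [classicalWave, hU, map_mul, Complex.conj_ofReal]
    rw [← hN, Complex.ofReal_mul, Complex.ofReal_pow, ← Complex.mul_conj']
    ring
  rw [e, integral_complex_ofReal, integral_const_mul, hsq]
  congr 1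
  field_simp

theorem one_add_spontaneousNumber_le {x : ℝ → ℝ} (hx : StrictMono x) {f : ℝ → ℂ}
    (hf : IsOutgoingWave f) (h0 : waveNorm (opA x f) ≠ 0) (ht : waveNorm (opA x f) ≠ ∞) :
    1 + spontaneousNumber x f ≤ stimulatedNumber x (classicalWave x f) f := by
  refine le_trans (add_le_add_left ?_ _) (spontaneousNumber_add_le_stimulatedNumber hx
    hf.integrable (isNormalizedWave_classicalWave hx hf.integrable h0 ht))
  rw [integral_opU_mul_conj_classicalWave hx hf.integrable h0 ht, ← ofReal_norm,
    Complex.norm_real, Real.norm_of_nonneg ENNReal.toReal_nonneg, ENNReal.ofReal_toReal ht]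
  exact (waveNorm_opA_sq_bounds hx hf).1

end StimulatedEmission

theorem mainTheorem6 (x : ℝ → ℝ) (hx : IsCoordTransformation x)
    (f : ℝ → ℂ) (hf : IsOutgoingWave f) :
    (∀ g : ℝ → ℂ, IsNormalizedWave g →
      spontaneousNumber x f ≤ stimulatedNumber x g f ∧
      stimulatedNumber x g f ≤ 1 + 3 * spontaneousNumber x f) ∧
    (waveNorm (opA x f) ≠ ∞ →
      waveNorm (opA x f) ≠ 0 ∧ IsNormalizedWave (classicalWave x f) ∧
      1 + spontaneousNumber x f ≤ stimulatedNumber x (classicalWave x f) f) := by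
  have hmono : StrictMono x := strictMono_of_deriv_pos hx.deriv_pos
  refine ⟨fun g hg => ⟨?_, stimulatedNumber_le hmono hf hg⟩, fun ht => ?_⟩
  · exact le_add_self.trans (spontaneousNumber_add_le_stimulatedNumber hmono hf.integrable hg)
  · have h0 : waveNorm (opA x f) ≠ 0 := fun h => by
      simpa [h] using (waveNorm_opA_sq_bounds hmono hf).1
    exact ⟨h0, isNormalizedWave_classicalWave hmono hf.integrable h0 ht,
      one_add_spontaneousNumber_le hmono hf h0 ht⟩
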